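/- Let $N\in\mathbb N$ and $1<p<N$, let $p^*=\frac{Np}{N-p}$, and let $\Omega\subset\mathbb R^N$ be a bounded open set. Let $W_0^{1,p}(\Omega)$, the closure of $C_c^\infty(\Omega)$ in $W^{1,p}(\Omega)$, be equipped with the norm $\|u\|=\big(\int_\Omega|\nabla u|^p\,dx\big)^{1/p}$, and let $W^{-1,p'}(\Omega)$ be its dual space with the dual norm. Let $g:\mathbb R\times\Omega\times\mathbb R\to\mathbb R$ be a Carathéodory function, i.e. $g(\lambda,\cdot,s)$ is measurable on $\Omega$ for all $(\lambda,s)\in\mathbb R^2$, and $g(\cdot,x,\cdot)$ is continuous on $\mathbb R^2$ for a.e. $x\in\Omega$. Assume that for every bounded set $J\subset\mathbb R$ there is a continuous, strictly increasing function $\bar f:[0,+\infty)\to[0,+\infty)$ with $\bar f(0)=0$ such that $$|g(\lambda,x,s)|\le\bar f(|s|)\qquad\text{for a.e. }x\in\Omega\text{ and all }(\lambda,s)\in J\times\mathbb R,$$ and such that (f1)$_\infty$ $\displaystyle\lim_{s\to+\infty}\frac{\bar f(s)}{s^{p^*-1}}=0$ (slightly subcritical growth); (f2)$_\infty$ $\bar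 f$ is increasing at infinity and there are constants $s_0>0$ and $c_0>1$ with $\dfrac{s\bar f(s)}{\bar F(s)}\ge c_0$ for all $s>s_0$, where $\bar F(s)=\int_0^s\bar f(t)\,dt$. Then for every bounded closed interval $I\subset\mathbb R$ the operator $G:I\times W_0^{1,p}(\Omega)\to W^{-1,p'}(\Omega)$, $$\langle G(\lambda,u),\psi\rangle=\int_\Omega g(\lambda,x,u(x))\,\psi(x)\,dx,\qquad \psi\in W_0^{1,p}(\Omega),$$ is well defined (the integrals converge absolutely and $G(\lambda,u)$ is a bounded linear functional) and compact: it is continuous and maps bounded sets to relatively compact sets. -/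

import Mathlib

open MeasureTheory Filter Topology
open scoped ENNReal NNReal ContDiff Gradient

noncomputable section

namespace Sobolev

instance fact_one_le_ofReal {p : ℝ} [hp : Fact (1 < p)] : Fact (1 ≤ ENNReal.ofReal p) :=
  ⟨by simpa using ENNReal.ofReal_le_ofReal hp.out.le⟩

/-- The product `L^p(Ω) × L^p(Ω; ℝ^N)`, in which `W^{1,p}(Ω)` embeds by `u ↦ (u, ∇u)` with
a norm equivalent to the usual one. -/
abbrev PairLp {N : ℕ} (Ω : Set (EuclideanSpace ℝ (Fin N))) (p : ℝ) : Type :=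
  Lp ℝ (ENNReal.ofReal p) (volume.restrict Ω) ×
    Lp (EuclideanSpace ℝ (Fin N)) (ENNReal.ofReal p) (volume.restrict Ω)

/-- `φ ∈ C_c^∞(Ω)`. -/
def IsTestFunction {N : ℕ} (Ω : Set (EuclideanSpace ℝ (Fin N)))
    (φ : EuclideanSpace ℝ (Fin N) → ℝ) : Prop :=
  ContDiff ℝ ∞ φ ∧ HasCompactSupport φ ∧ tsupport φ ⊆ Ω

/-- The subspace `{(φ, ∇φ) : φ ∈ C_c^∞(Ω)}`. -/
def testPairs {N : ℕ} (Ω : Set (EuclideanSpace ℝ (Fin N))) (p : ℝ) [Fact (1 < p)] :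
    Submodule ℝ (PairLp Ω p) where
  carrier := {w | ∃ φ : EuclideanSpace ℝ (Fin N) → ℝ, IsTestFunction Ω φ ∧
    w.1 =ᵐ[volume.restrict Ω] φ ∧ w.2 =ᵐ[volume.restrict Ω] ∇ φ}
  zero_mem' := by
    refine ⟨0, ⟨contDiff_const, HasCompactSupport.zero, by simp [tsupport]⟩,
      Lp.coeFn_zero _ _ _, ?_⟩
    filter_upwards [Lp.coeFn_zero (EuclideanSpace ℝ (Fin N)) (ENNReal.ofReal p)
      (volume.restrict Ω)] with x hx
    have h0 : ∇ (0 : EuclideanSpace ℝ (Fin N) → ℝ) x = 0 := by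
      simp [gradient]
    rw [h0]
    exact hx
  add_mem' := by
    rintro w z ⟨φ, ⟨hφ, hφc, hφs⟩, h1, h2⟩ ⟨χ, ⟨hχ, hχc, hχs⟩, h3, h4⟩
    refine ⟨φ + χ, ⟨hφ.add hχ, hφc.add hχc,
      (tsupport_add φ χ).trans (Set.union_subset hφs hχs)⟩, ?_, ?_⟩
    · filter_upwards [h1, h3, Lp.coeFn_add w.1 z.1] with x a b c
      rw [Prod.fst_add, c, Pi.add_apply, a, b, Pi.add_apply]
    · filter_upwards [h2, h4, Lp.coeFn_add w.2 z.2] with x a b c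
      rw [Prod.snd_add, c, Pi.add_apply, a, b]
      simp only [gradient]
      rw [fderiv_add (hφ.differentiable (by simp) x) (hχ.differentiable (by simp) x), map_add]
  smul_mem' := by
    rintro r w ⟨φ, ⟨hφ, hφc, hφs⟩, h1, h2⟩
    refine ⟨r • φ, ⟨contDiff_const.smul hφ, hφc.smul_left (f := fun _ => r),
      (tsupport_smul_subset_right (fun _ => r) φ).trans hφs⟩, ?_, ?_⟩
    · filter_upwards [h1, Lp.coeFn_smul r w.1] with x a c
      rw [Prod.smul_fst, c, Pi.smul_apply, a, Pi.smul_apply]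
    · filter_upwards [h2, Lp.coeFn_smul r w.2] with x a c
      rw [Prod.smul_snd, c, Pi.smul_apply, a]
      simp only [gradient]
      rw [fderiv_const_smul (hφ.differentiable (by simp) x)]
      simp

/-- `W_0^{1,p}(Ω)`, the closure of `C_c^∞(Ω)` in the norm of `W^{1,p}(Ω)`. An element is stored as
the pair of the function and its weak gradient. -/
def W01p {N : ℕ} (Ω : Set (EuclideanSpace ℝ (Fin N))) (p : ℝ) [Fact (1 < p)] : Type :=
  (testPairs Ω p).topologicalClosure

namespace W01p

variable {N : ℕ} {Ω : Set (EuclideanSpace ℝ (Fin N))} {p : ℝ} [hp : Fact (1 < p)]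

instance : AddCommGroup (W01p Ω p) :=
  inferInstanceAs (AddCommGroup ((testPairs Ω p).topologicalClosure))

instance : Module ℝ (W01p Ω p) :=
  inferInstanceAs (Module ℝ ((testPairs Ω p).topologicalClosure))

/-- The underlying function of an element of `W_0^{1,p}(Ω)`. -/
instance : CoeFun (W01p Ω p) (fun _ => EuclideanSpace ℝ (Fin N) → ℝ) where
  coe u := (Subtype.val u : PairLp Ω p).1

/-- The weak gradient, as a linear map to `L^p(Ω; ℝ^N)`. -/
def grad (Ω : Set (EuclideanSpace ℝ (Fin N))) (p : ℝ) [Fact (1 < p)] :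
    W01p Ω p →ₗ[ℝ] Lp (EuclideanSpace ℝ (Fin N)) (ENNReal.ofReal p) (volume.restrict Ω) :=
  (LinearMap.snd ℝ _ _).comp ((testPairs Ω p).topologicalClosure.subtype)

/-- Poincaré's inequality on `W_0^{1,p}(Ω)`. -/
theorem poincare (hΩ : Bornology.IsBounded Ω) (hpN : p < N) :
    ∃ C : ℝ, ∀ w ∈ (testPairs Ω p).topologicalClosure, ‖w.1‖ ≤ C * ‖w.2‖ := by
  have hp1 : 1 < p := hp.out
  let C : ℝ≥0 := eLpNormLESNormFDerivOfLeConst ℝ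
    (volume : Measure (EuclideanSpace ℝ (Fin N))) Ω p.toNNReal p.toNNReal
  refine ⟨C, fun w hw => ?_⟩
  have hcl : IsClosed {w : PairLp Ω p | ‖w.1‖ ≤ C * ‖w.2‖} :=
    isClosed_le (by fun_prop) (by fun_prop)
  refine closure_minimal ?_ hcl hw
  rintro z ⟨φ, ⟨hφ, hφc, hφs⟩, h1, h2⟩
  have hsupp : φ.support ⊆ Ω := (subset_tsupport φ).trans hφs
  have hgrad : eLpNorm (∇ φ) (ENNReal.ofReal p) volume =
      eLpNorm (fderiv ℝ φ) (ENNReal.ofReal p) volume := by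
    refine eLpNorm_congr_norm_ae (Eventually.of_forall fun x => ?_)
    simp [gradient]
  have hgsupp : (∇ φ).support ⊆ Ω := by
    intro x hx
    refine hφs (support_fderiv_subset (𝕜 := ℝ) (f := φ) ?_)
    intro h
    exact hx (by simp [gradient, h])
  have key : eLpNorm φ (ENNReal.ofReal p) volume ≤
      C * eLpNorm (fderiv ℝ φ) (ENNReal.ofReal p) volume :=
    eLpNorm_le_eLpNorm_fderiv volume (hφ.of_le (by simp)) hsupp
      (by simpa using hp1.le)
      (by rw [finrank_euclideanSpace_fin]; exact Real.toNNReal_lt_natCast'.2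
            ⟨hpN, fun h => by subst h; norm_num at hpN; linarith⟩) hΩ
  have e1 : eLpNorm z.1 (ENNReal.ofReal p) (volume.restrict Ω) =
      eLpNorm φ (ENNReal.ofReal p) volume := by
    rw [eLpNorm_congr_ae h1, eLpNorm_restrict_eq_of_support_subset hsupp]
  have e2 : eLpNorm z.2 (ENNReal.ofReal p) (volume.restrict Ω) =
      eLpNorm (fderiv ℝ φ) (ENNReal.ofReal p) volume := by
    rw [eLpNorm_congr_ae h2, eLpNorm_restrict_eq_of_support_subset hgsupp, hgrad]
  rw [← e1, ← e2] at key
  change ‖z.1‖ ≤ C * ‖z.2‖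
  rw [Lp.norm_def, Lp.norm_def]
  have := ENNReal.toReal_mono (ENNReal.mul_ne_top ENNReal.coe_ne_top (Lp.eLpNorm_ne_top z.2)) key
  simpa [ENNReal.toReal_mul] using this

theorem grad_injective (hΩ : Bornology.IsBounded Ω) (hpN : p < N) :
    Function.Injective (grad Ω p) := by
  rw [injective_iff_map_eq_zero]
  intro u hu
  obtain ⟨C, hC⟩ := poincare (p := p) hΩ hpN
  have h := hC u.1 u.2
  have h2 : (Subtype.val u : PairLp Ω p).2 = 0 := hu
  rw [h2, norm_zero, mul_zero, norm_le_zero_iff] at h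
  exact Subtype.ext (Prod.ext h h2)

variable [hΩ : Fact (Bornology.IsBounded Ω)] [hpN : Fact (p < N)]

/-- The norm `‖u‖ = (∫_Ω |∇u|^p)^{1/p}` on `W_0^{1,p}(Ω)`, for bounded `Ω` and `1 < p < N`. -/
instance : NormedAddCommGroup (W01p Ω p) :=
  NormedAddCommGroup.induced _ _ (grad Ω p) (grad_injective hΩ.out hpN.out)

instance : NormedSpace ℝ (W01p Ω p) :=
  NormedSpace.induced ℝ _ _ (grad Ω p)

end W01p

/-- `W^{-1,p'}(Ω)`, the dual space of `W_0^{1,p}(Ω)` with the dual norm. -/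
abbrev WNeg {N : ℕ} (Ω : Set (EuclideanSpace ℝ (Fin N))) (p : ℝ) [Fact (1 < p)]
    [Fact (Bornology.IsBounded Ω)] [Fact (p < N)] : Type :=
  StrongDual ℝ (W01p Ω p)

/-- The critical Sobolev exponent `p* = N p / (N - p)`. -/
def critExp (N : ℕ) (p : ℝ) : ℝ := N * p / (N - p)

/-- `f` is slightly subcritical: `f(s) / |s|^{p* - 1} → 0` as `s → +∞`. -/
def SlightlySubcritical (N : ℕ) (p : ℝ) (f : ℝ → ℝ) : Prop :=
  Tendsto (fun s => f s / |s| ^ (critExp N p - 1)) atTop (𝓝 0)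

/-- `f` is increasing at infinity and `s f(s) / F(s) ≥ c₀ > 1` for all large `s`, where `F` is the
primitive of `f` with `F(0) = 0`. -/
def SuperlinearAtInfinity (f : ℝ → ℝ) : Prop :=
  (∃ s₁, MonotoneOn f (Set.Ici s₁)) ∧
    ∃ s₀ > 0, ∃ c₀ > 1, ∀ s > s₀, c₀ ≤ s * f s / ∫ t in (0 : ℝ)..s, f t

/-- `g : ℝ × Ω × ℝ → ℝ`, `(λ, x, s) ↦ g λ x s`, is a Carathéodory function: Lebesgue measurable
in `x ∈ Ω` for all `(λ, s)`, and continuous in `(λ, s)` for almost every `x ∈ Ω`. -/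
def IsCaratheodory {N : ℕ} (Ω : Set (EuclideanSpace ℝ (Fin N)))
    (g : ℝ → EuclideanSpace ℝ (Fin N) → ℝ → ℝ) : Prop :=
  (∀ l s, AEMeasurable (fun x => g l x s) (volume.restrict Ω)) ∧
    ∀ᵐ x ∂(volume.restrict Ω), Continuous fun q : ℝ × ℝ => g q.1 x q.2

/-- A (nonlinear) compact operator: continuous, and the image of every bounded set is relatively
compact. -/
def IsCompactMap {X Y : Type*} [PseudoMetricSpace X] [TopologicalSpace Y] (T : X → Y) : Prop :=
  Continuous T ∧ ∀ B : Set X, Bornology.IsBounded B → IsCompact (closure (T '' B))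

/-- `T(λ, u) ∈ W^{-1,p'}(Ω)` is given by `⟨T(λ, u), ψ⟩ = ∫_Ω g(λ, x, u) ψ dx`, where the integral
converges absolutely. -/
def IsNemytskii {N : ℕ} (Ω : Set (EuclideanSpace ℝ (Fin N))) (p : ℝ) [Fact (1 < p)]
    [Fact (Bornology.IsBounded Ω)] [Fact (p < N)] (I : Set ℝ)
    (g : ℝ → EuclideanSpace ℝ (Fin N) → ℝ → ℝ) (T : I × W01p Ω p → WNeg Ω p) : Prop :=
  ∀ (l : I) (u ψ : W01p Ω p), IntegrableOn (fun x => g l x (u x) * ψ x) Ω ∧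
    T (l, u) ψ = ∫ x in Ω, g l x (u x) * ψ x

end Sobolev

end

/-! Write `q = p*` and let `q'` be its conjugate exponent. The operator factors as `(λ, u) ↦ g(λ, ·,
u) ∈ L^{q'}(Ω)` followed by the adjoint `L^{q'}(Ω) → W^{-1,p'}(Ω)` of the Sobolev embedding, so only
the first, nonlinear map needs study.

Strict subcriticality gives `|g(λ, x, s)| ≤ ε |s|^{q-1} + C_ε` for every `ε > 0`. Along a sequence
bounded in `L^q`, the functions `g(λ_n, ·, u_n)` are therefore uniformly integrable in `L^{q'}`, and
Vitali's theorem turns a.e. convergence of `u_n` and convergence of `λ_n` into convergence in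
`L^{q'}` (`HasSubcriticalGrowth.tendsto_eLpNorm_comp_sub`). Continuity and compactness both reduce
to extracting an a.e. convergent subsequence: from a convergent sequence this is standard, from a
bounded one it is a weak form of Rellich's theorem (`exists_subseq_tendsto_ae`).

As a.e. convergence is all that is needed, Rellich is proved in `L¹`: mollification moves a test
function by at most `δ ‖∇φ‖₁`, and the mollified family is precompact by Arzelà–Ascoli. -/

noncomputable section

namespace Sobolev

/-! ### Equicontinuity and precompactness of mollified families -/

section Kernel

variable {E : Type*} [NormedAddCommGroup E] [MeasurableSpace E] (μ : Measure E)

/-- Convolution of `φ` with the kernel `η`. -/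
def mollify (η φ : E → ℝ) (x : E) : ℝ := ∫ t, η (x - t) * φ t ∂μ

variable [BorelSpace E] [IsFiniteMeasureOnCompacts μ]

theorem abs_mollify_sub_le {η φ : E → ℝ} {C M : ℝ} (hη : Continuous η) (hφ : Continuous φ)
    (hφc : HasCompactSupport φ) (hM : ∫ t, |φ t| ∂μ ≤ M) (x y : E) (hC : 0 ≤ C)
    (h : ∀ t, |η (x - t) - η (y - t)| ≤ C) :
    |mollify μ η φ x - mollify μ η φ y| ≤ C * M := by
  have hi : ∀ x, Integrable (fun t => η (x - t) * φ t) μ := fun x =>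
    ((hη.comp (by fun_prop)).mul hφ).integrable_of_hasCompactSupport hφc.mul_left
  have hφi : Integrable (fun t => |φ t|) μ := (hφ.integrable_of_hasCompactSupport hφc).abs
  rw [mollify, mollify, ← integral_sub (hi x) (hi y)]
  refine (abs_integral_le_integral_abs).trans ?_
  calc ∫ t, |η (x - t) * φ t - η (y - t) * φ t| ∂μ ≤ ∫ t, C * |φ t| ∂μ := by
        refine integral_mono ((hi x).sub (hi y)).abs (hφi.const_mul C) fun t => ?_
        simp only [← sub_mul, abs_mul]
        exact mul_le_mul_of_nonneg_right (h t) (abs_nonneg _)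
    _ ≤ C * M := by
        rw [integral_const_mul]
        gcongr

theorem abs_mollify_le {η φ : E → ℝ} {C M : ℝ} (hη : Continuous η) (hφ : Continuous φ)
    (hφc : HasCompactSupport φ) (hM : ∫ t, |φ t| ∂μ ≤ M) (hC : 0 ≤ C) (h : ∀ t, |η t| ≤ C)
    (x : E) : |mollify μ η φ x| ≤ C * M := by
  have hi : Integrable (fun t => η (x - t) * φ t) μ :=
    ((hη.comp (by fun_prop)).mul hφ).integrable_of_hasCompactSupport hφc.mul_left
  have hφi : Integrable (fun t => |φ t|) μ := (hφ.integrable_of_hasCompactSupport hφc).abs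
  refine (abs_integral_le_integral_abs).trans ?_
  calc ∫ t, |η (x - t) * φ t| ∂μ ≤ ∫ t, C * |φ t| ∂μ := by
        refine integral_mono hi.abs (hφi.const_mul C) fun t => ?_
        simp only [abs_mul]
        exact mul_le_mul_of_nonneg_right (h _) (abs_nonneg _)
    _ ≤ C * M := by
        rw [integral_const_mul]
        gcongr

/-- The mollifications of an `L¹`-bounded family have a finite uniform `ε`-net on every compact
set. -/
theorem exists_finite_net_mollify {η : E → ℝ} (hη : Continuous η) (hηc : HasCompactSupport η)
    {K : Set E} (hK : IsCompact K) (M : ℝ) {A : Set (E → ℝ)}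
    (hA : ∀ φ ∈ A, Continuous φ ∧ HasCompactSupport φ ∧ ∫ t, |φ t| ∂μ ≤ M)
    {ε : ℝ} (hε : 0 < ε) :
    ∃ B ⊆ A, B.Finite ∧ ∀ φ ∈ A, ∃ χ ∈ B, ∀ x ∈ K, |mollify μ η φ x - mollify μ η χ x| < ε := by
  have : CompactSpace K := isCompact_iff_compactSpace.1 hK
  obtain ⟨C, hC⟩ := hηc.exists_bound_of_continuous hη
  have hC0 : 0 ≤ C := (norm_nonneg _).trans (hC 0)
  have huc : UniformContinuous η := hηc.uniformContinuous_of_continuous hη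
  have hmod : ∀ r > 0, ∃ d > 0, ∀ φ ∈ A, ∀ x y, dist x y < d →
      |mollify μ η φ x - mollify μ η φ y| < r := by
    intro r hr
    -- The modulus depends only on `η` and `M`, hence is common to all of `A`. The `+ 1` covers `M =
    -- 0` and makes the final inequality strict.
    have hr' : 0 < r / (|M| + 1) := by positivity
    obtain ⟨d, hd, h⟩ := Metric.uniformContinuous_iff.1 huc _ hr'
    refine ⟨d, hd, fun φ hφ x y hxy => ?_⟩
    obtain ⟨h1, h2, h3⟩ := hA φ hφ
    refine (abs_mollify_sub_le μ hη h1 h2 (h3.trans (le_abs_self M)) x y hr'.le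
      fun t => (h (by simpa using hxy)).le).trans_lt ?_
    rw [div_mul_eq_mul_div, div_lt_iff₀ (by positivity)]
    nlinarith [abs_nonneg M]
  have hcont : ∀ φ ∈ A, Continuous (mollify μ η φ) := by
    intro φ hφ
    refine Metric.continuous_iff.2 fun x r hr => ?_
    obtain ⟨d, hd, h⟩ := hmod r hr
    exact ⟨d, hd, fun y hy => h φ hφ y x hy⟩
  let F : A → BoundedContinuousFunction K ℝ := fun φ =>
    BoundedContinuousFunction.mkOfCompact ⟨fun x => mollify μ η φ x,
      (hcont φ φ.2).comp continuous_subtype_val⟩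
  have hcomp : IsCompact (closure (Set.range F)) := by
    refine BoundedContinuousFunction.arzela_ascoli (Metric.closedBall 0 (C * M))
      (isCompact_closedBall _ _) _ ?_ ?_
    · rintro _ x ⟨φ, rfl⟩
      obtain ⟨h1, h2, h3⟩ := hA φ φ.2
      simpa [F] using abs_mollify_le μ hη h1 h2 h3 hC0 hC x
    · refine UniformEquicontinuous.equicontinuous (Metric.uniformEquicontinuous_iff.2 ?_)
      intro r hr
      obtain ⟨d, hd, h⟩ := hmod r hr
      refine ⟨d, hd, ?_⟩
      rintro x y hxy ⟨_, φ, rfl⟩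
      exact h φ φ.2 x y hxy
  have htb : TotallyBounded (Set.range F) := hcomp.totallyBounded.subset subset_closure
  obtain ⟨t, ht, htf, hcov⟩ := Metric.finite_approx_of_totallyBounded htb ε hε
  -- The net lies in the range of `F`, so it can be pulled back to finitely many members of `A`.
  rw [← Set.image_univ] at ht
  obtain ⟨B, -, hBf, hcov⟩ := Set.exists_subset_image_finite_and
    (p := fun t => Set.range F ⊆ ⋃ y ∈ t, Metric.ball y ε) |>.1 ⟨t, ht, htf, hcov⟩
  refine ⟨Subtype.val '' B, by simp, hBf.image _, fun φ hφ => ?_⟩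
  have := hcov ⟨⟨φ, hφ⟩, rfl⟩
  simp only [Set.mem_iUnion, Metric.mem_ball] at this
  obtain ⟨_, ⟨χ, hχ, rfl⟩, hlt⟩ := this
  refine ⟨χ, ⟨χ, hχ, rfl⟩, fun x hx => ?_⟩
  exact (BoundedContinuousFunction.dist_coe_le_dist (f := F ⟨φ, hφ⟩) (g := F χ) ⟨x, hx⟩).trans_lt hlt

end Kernel

/-! ### The `L¹` error of mollification -/

section Mollification

variable {E : Type*} [NormedAddCommGroup E] [NormedSpace ℝ E]

/-- Fundamental theorem of calculus on the segment from `x - y` to `x`. -/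
theorem enorm_sub_le_lintegral_fderiv {φ : E → ℝ} (hφ : ContDiff ℝ 1 φ) (x y : E) :
    ‖φ x - φ (x - y)‖ₑ ≤
      ∫⁻ t in Set.Ioc (0 : ℝ) 1, ‖fderiv ℝ φ (x - y + t • y)‖ₑ * ‖y‖ₑ := by
  have hd : ∀ t ∈ Set.uIcc (0 : ℝ) 1,
      HasDerivAt (fun t : ℝ => φ (x - y + t • y)) (fderiv ℝ φ (x - y + t • y) y) t := by
    intro t _
    have h1 : HasDerivAt (fun t : ℝ => x - y + t • y) y t := by
      simpa using ((hasDerivAt_id t).smul_const y).const_add (x - y)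
    exact ((hφ.differentiable (by simp)) _).hasFDerivAt.comp_hasDerivAt t h1
  have hcont : Continuous fun t : ℝ => fderiv ℝ φ (x - y + t • y) y :=
    ((hφ.continuous_fderiv (by simp)).comp (by fun_prop)).clm_apply continuous_const
  have h := intervalIntegral.integral_eq_sub_of_hasDerivAt hd (hcont.intervalIntegrable 0 1)
  simp only [one_smul, sub_add_cancel, zero_smul, add_zero] at h
  rw [← h, intervalIntegral.integral_of_le zero_le_one]
  refine (enorm_integral_le_lintegral_enorm _).trans (lintegral_mono fun t => ?_)
  exact ContinuousLinearMap.le_opENorm _ _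

variable [FiniteDimensional ℝ E] [MeasurableSpace E] [BorelSpace E]
  (μ : Measure E) [μ.IsAddHaarMeasure]

/-- After Tonelli, translation invariance of `μ` makes the inner integral independent of `t`. -/
theorem lintegral_enorm_sub_translate_le {φ : E → ℝ} (hφ : ContDiff ℝ 1 φ) (y : E) :
    ∫⁻ x, ‖φ x - φ (x - y)‖ₑ ∂μ ≤ ‖y‖ₑ * ∫⁻ x, ‖fderiv ℝ φ x‖ₑ ∂μ := by
  have hc : Continuous (fderiv ℝ φ) := hφ.continuous_fderiv (by simp)
  calc ∫⁻ x, ‖φ x - φ (x - y)‖ₑ ∂μ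
      ≤ ∫⁻ x, (∫⁻ t in Set.Ioc (0 : ℝ) 1, ‖fderiv ℝ φ (x - y + t • y)‖ₑ * ‖y‖ₑ) ∂μ :=
        lintegral_mono fun x => enorm_sub_le_lintegral_fderiv hφ x y
    _ = ∫⁻ t : ℝ in Set.Ioc (0 : ℝ) 1, ∫⁻ x : E, ‖fderiv ℝ φ (x - y + t • y)‖ₑ * ‖y‖ₑ ∂μ := by
        refine lintegral_lintegral_swap (Measurable.aemeasurable ?_)
        refine Measurable.mul_const ?_ _
        exact (hc.comp (by fun_prop :
          Continuous fun z : E × ℝ => z.1 - y + z.2 • y)).enorm.measurable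
    _ = ∫⁻ _ : ℝ in Set.Ioc (0 : ℝ) 1, ‖y‖ₑ * ∫⁻ x, ‖fderiv ℝ φ x‖ₑ ∂μ := by
        refine lintegral_congr fun t => ?_
        have hm : Measurable fun x => ‖fderiv ℝ φ (x - y + t • y)‖ₑ :=
          (hc.comp (by fun_prop : Continuous fun x => x - y + t • y)).enorm.measurable
        rw [lintegral_mul_const _ hm, mul_comm]
        congr 1
        have := lintegral_add_right_eq_self (μ := μ) (fun x => ‖fderiv ℝ φ x‖ₑ) (-y + t • y)
        simpa [sub_eq_add_neg, add_assoc] using this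
    _ = ‖y‖ₑ * ∫⁻ x, ‖fderiv ℝ φ x‖ₑ ∂μ := by simp

/-- Since `∫ η = 1`, the error `φ - η * φ` is the `η`-average of the differences `φ - φ(· - y)`, and
only `‖y‖ ≤ δ` contributes. -/
theorem lintegral_enorm_sub_mollify_le {η φ : E → ℝ} {δ : ℝ} (hη : Continuous η)
    (hηc : HasCompactSupport η) (hη0 : ∀ x, 0 ≤ η x) (hη1 : ∫ x, η x ∂μ = 1)
    (hηδ : ∀ x, η x ≠ 0 → ‖x‖ ≤ δ) (hφ : ContDiff ℝ 1 φ) :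
    ∫⁻ x, ‖φ x - mollify μ η φ x‖ₑ ∂μ ≤ ENNReal.ofReal δ * ∫⁻ x, ‖fderiv ℝ φ x‖ₑ ∂μ := by
  have hint : Integrable η μ := hη.integrable_of_hasCompactSupport hηc
  have hη1' : ∫⁻ x, ‖η x‖ₑ ∂μ = 1 := by
    rw [← ofReal_integral_norm_eq_lintegral_enorm hint]
    simp [abs_of_nonneg (hη0 _), hη1]
  have hmol : ∀ x, φ x - mollify μ η φ x = ∫ y, η y * (φ x - φ (x - y)) ∂μ := by
    intro x
    have e : mollify μ η φ x = ∫ y, η y * φ (x - y) ∂μ := by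
      rw [mollify, ← integral_sub_left_eq_self _ μ x]
      simp
    have h2 : Integrable (fun y => η y * φ (x - y)) μ :=
      (hη.mul (hφ.continuous.comp (by fun_prop))).integrable_of_hasCompactSupport hηc.mul_right
    simp_rw [mul_sub]
    rw [integral_sub (hint.mul_const _) h2, integral_mul_const, hη1, one_mul, e]
  calc ∫⁻ x, ‖φ x - mollify μ η φ x‖ₑ ∂μ
      ≤ ∫⁻ x, ∫⁻ y, ‖η y‖ₑ * ‖φ x - φ (x - y)‖ₑ ∂μ ∂μ := by
        refine lintegral_mono fun x => ?_
        rw [hmol]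
        refine (enorm_integral_le_lintegral_enorm _).trans (le_of_eq ?_)
        simp [enorm_mul]
    _ = ∫⁻ y, ∫⁻ x, ‖η y‖ₑ * ‖φ x - φ (x - y)‖ₑ ∂μ ∂μ := by
        refine lintegral_lintegral_swap (Measurable.aemeasurable ?_)
        have h1 : Continuous fun z : E × E => η z.2 := by fun_prop
        have h2 : Continuous fun z : E × E => φ z.1 - φ (z.1 - z.2) :=
          (hφ.continuous.comp (by fun_prop)).sub (hφ.continuous.comp (by fun_prop))
        exact h1.enorm.measurable.mul h2.enorm.measurable
    _ ≤ ∫⁻ y, ‖η y‖ₑ * (ENNReal.ofReal δ * ∫⁻ x, ‖fderiv ℝ φ x‖ₑ ∂μ) ∂μ := by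
        refine lintegral_mono fun y => ?_
        have hm : Measurable fun x => ‖φ x - φ (x - y)‖ₑ :=
          (hφ.continuous.sub (hφ.continuous.comp (by fun_prop))).enorm.measurable
        simp only [lintegral_const_mul _ hm]
        by_cases hy : η y = 0
        · simp [hy]
        gcongr
        refine (lintegral_enorm_sub_translate_le μ hφ y).trans ?_
        gcongr
        rw [← ofReal_norm]
        exact ENNReal.ofReal_le_ofReal (hηδ y hy)
    _ = _ := by
        rw [lintegral_mul_const _ hη.enorm.measurable, hη1', one_mul]

/-- An `L¹`-bounded family of compactly supported `C¹` functions with `L¹`-bounded gradients has a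
finite `ε`-net in `L¹` of every bounded set. -/
theorem exists_finite_net_lintegral {Ω : Set E} (hΩm : MeasurableSet Ω)
    (hΩ : Bornology.IsBounded Ω) (M : ℝ≥0)
    {A : Set (E → ℝ)}
    (hA : ∀ φ ∈ A, ContDiff ℝ 1 φ ∧ HasCompactSupport φ ∧ ∫⁻ x, ‖φ x‖ₑ ∂μ ≤ M ∧
      ∫⁻ x, ‖fderiv ℝ φ x‖ₑ ∂μ ≤ M) {ε : ℝ≥0} (hε : 0 < ε) :
    ∃ B ⊆ A, B.Finite ∧ ∀ φ ∈ A, ∃ χ ∈ B, ∫⁻ x in Ω, ‖φ x - χ x‖ₑ ∂μ ≤ ε := by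
  obtain ⟨δ, hδ, hδM⟩ : ∃ δ : ℝ, 0 < δ ∧ ENNReal.ofReal δ * M ≤ ENNReal.ofReal (ε / 3) := by
    refine ⟨ε / 3 / (M + 1), by positivity, ?_⟩
    rw [← ENNReal.ofReal_coe_nnreal, ← ENNReal.ofReal_mul (by positivity)]
    refine ENNReal.ofReal_le_ofReal ?_
    rw [div_mul_eq_mul_div, div_le_iff₀ (by positivity)]
    gcongr
    simp
  have hΩμ : μ Ω ≠ ⊤ := hΩ.measure_lt_top.ne
  obtain ⟨r, hr, hrΩ⟩ : ∃ r : ℝ, 0 < r ∧ ENNReal.ofReal r * μ Ω ≤ ENNReal.ofReal (ε / 3) := by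
    refine ⟨ε / 3 / ((μ Ω).toReal + 1), by positivity, ?_⟩
    rw [← ENNReal.ofReal_toReal hΩμ, ← ENNReal.ofReal_mul (by positivity)]
    refine ENNReal.ofReal_le_ofReal ?_
    rw [div_mul_eq_mul_div, ENNReal.toReal_ofReal (by positivity), div_le_iff₀ (by positivity)]
    gcongr
    simp
  let bump : ContDiffBump (0 : E) := ⟨δ / 2, δ, by positivity, by linarith⟩
  let η := bump.normed μ
  have hη : Continuous η := bump.continuous_normed
  have hηc : HasCompactSupport η := bump.hasCompactSupport_normed
  obtain ⟨B, hBA, hBf, hB⟩ := exists_finite_net_mollify μ hη hηc hΩ.isCompact_closure M (A := A)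
    (fun φ hφ => by
      obtain ⟨h1, h2, h3, -⟩ := hA φ hφ
      refine ⟨h1.continuous, h2, ?_⟩
      have := integral_norm_eq_lintegral_enorm (μ := μ) (f := φ)
        h1.continuous.aestronglyMeasurable
      simp only [Real.norm_eq_abs] at this
      rw [this]
      exact ENNReal.toReal_le_of_le_ofReal M.2 (by simpa using h3)) hr
  refine ⟨B, hBA, hBf, fun φ hφ => ?_⟩
  obtain ⟨χ, hχ, hφχ⟩ := hB φ hφ
  refine ⟨χ, hχ, ?_⟩
  have hmol : ∀ φ ∈ A, ∫⁻ x in Ω, ‖φ x - mollify μ η φ x‖ₑ ∂μ ≤ ENNReal.ofReal (ε / 3) := by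
    intro φ hφ
    obtain ⟨h1, -, -, h4⟩ := hA φ hφ
    refine (setLIntegral_le_lintegral _ _).trans
      ((lintegral_enorm_sub_mollify_le μ hη hηc (fun x => bump.nonneg_normed x)
        bump.integral_normed (fun x hx => ?_) h1).trans (le_trans (by gcongr) hδM))
    have : x ∈ Function.support η := hx
    rw [bump.support_normed_eq] at this
    simpa [bump] using (mem_ball_zero_iff.1 this).le
  have hmm : ∀ φ ∈ A, Measurable fun x => ‖φ x - mollify μ η φ x‖ₑ := by
    intro φ hφ
    have hm : StronglyMeasurable (mollify μ η φ) := by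
      refine StronglyMeasurable.integral_prod_right
        (f := fun x t => η (x - t) * φ t) ?_
      exact ((hη.comp (by fun_prop)).mul
        ((hA φ hφ).1.continuous.comp continuous_snd)).stronglyMeasurable
    exact ((hA φ hφ).1.continuous.measurable.sub hm.measurable).enorm
  -- Three thirds of `ε`: two mollification errors, and the uniform distance `r` of the mollified
  -- functions integrated over `Ω`.
  calc ∫⁻ x in Ω, ‖φ x - χ x‖ₑ ∂μ
      ≤ ∫⁻ x in Ω, (‖φ x - mollify μ η φ x‖ₑ + ENNReal.ofReal r) + ‖χ x - mollify μ η χ x‖ₑ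
          ∂μ := by
        refine setLIntegral_mono' hΩm ?_
        intro x hx
        have h : φ x - χ x = (φ x - mollify μ η φ x) + (mollify μ η φ x - mollify μ η χ x)
          - (χ x - mollify μ η χ x) := by ring
        rw [h]
        refine enorm_sub_le.trans (add_le_add ((enorm_add_le _ _).trans
          (add_le_add le_rfl ?_)) le_rfl)
        rw [Real.enorm_eq_ofReal_abs]
        exact ENNReal.ofReal_le_ofReal (hφχ x (subset_closure hx)).le
    _ ≤ ENNReal.ofReal (ε / 3) + ENNReal.ofReal (ε / 3) + ENNReal.ofReal (ε / 3) := by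
        rw [lintegral_add_right _ (hmm χ (hBA hχ)), lintegral_add_right _ measurable_const]
        gcongr
        · exact hmol φ hφ
        · simpa using hrΩ
        · exact hmol χ (hBA hχ)
    _ = ε := by
        rw [← ENNReal.ofReal_add (by positivity) (by positivity),
          ← ENNReal.ofReal_add (by positivity) (by positivity)]
        ring_nf
        simp

end Mollification

/-! ### Sobolev embedding and a.e. precompactness -/

section Embedding

variable {N : ℕ} {Ω : Set (EuclideanSpace ℝ (Fin N))} {p : ℝ} [hp : Fact (1 < p)]

/-- Supports lie in `Ω`, so norms over `Ω` become norms over the whole space, where inequalities for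
compactly supported functions apply without regularity of `∂Ω`. -/
theorem exists_testFunction_of_mem_testPairs {z : PairLp Ω p} (hz : z ∈ testPairs Ω p) :
    ∃ φ, IsTestFunction Ω φ ∧ z.1 =ᵐ[volume.restrict Ω] φ ∧
      (∀ r, eLpNorm φ r volume = eLpNorm z.1 r (volume.restrict Ω)) ∧
      ∀ r, eLpNorm (fderiv ℝ φ) r volume = eLpNorm z.2 r (volume.restrict Ω) := by
  obtain ⟨φ, ⟨hφ, hφc, hφs⟩, h1, h2⟩ := hz
  refine ⟨φ, ⟨hφ, hφc, hφs⟩, h1, fun r => ?_, fun r => ?_⟩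
  · rw [eLpNorm_congr_ae h1,
      eLpNorm_restrict_eq_of_support_subset ((subset_tsupport φ).trans hφs)]
  · have hgsupp : (∇ φ).support ⊆ Ω := by
      intro x hx
      refine hφs (support_fderiv_subset (𝕜 := ℝ) (f := φ) ?_)
      intro h
      exact hx (by simp [gradient, h])
    rw [eLpNorm_congr_ae h2, eLpNorm_restrict_eq_of_support_subset hgsupp]
    exact eLpNorm_congr_norm_ae (Eventually.of_forall fun x => by simp [gradient])

theorem exists_seq_testPairs (u : W01p Ω p) :
    ∃ z : ℕ → PairLp Ω p, (∀ n, z n ∈ testPairs Ω p) ∧ Tendsto z atTop (𝓝 (Subtype.val u)) := by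
  have h : Subtype.val u ∈ closure (testPairs Ω p : Set (PairLp Ω p)) := u.2
  obtain ⟨z, hz, hlim⟩ := mem_closure_iff_seq_limit.1 h
  exact ⟨z, hz, hlim⟩

theorem exists_subseq_tendsto_ae_of_tendsto_Lp {α F : Type*} [MeasurableSpace α]
    [NormedAddCommGroup F] {μ : Measure α} {r : ℝ≥0∞} [Fact (1 ≤ r)] {f : ℕ → Lp F r μ}
    {g : Lp F r μ} (h : Tendsto f atTop (𝓝 g)) :
    ∃ ns : ℕ → ℕ, StrictMono ns ∧ ∀ᵐ x ∂μ, Tendsto (fun n => f (ns n) x) atTop (𝓝 (g x)) :=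
  (tendstoInMeasure_of_tendsto_Lp h).exists_seq_tendsto_ae

theorem one_lt_critExp (hpN : p < N) : 1 < critExp N p := by
  have hp1 := hp.out
  rw [critExp, one_lt_div (by linarith)]
  nlinarith

/-- The Gagliardo–Nirenberg–Sobolev inequality for test functions passes to the closure by Fatou
along an a.e. convergent subsequence, while the gradient norms converge. -/
theorem exists_sobolev_const (hpN : p < N) :
    ∃ C : ℝ≥0, ∀ u : W01p Ω p,
      eLpNorm u (ENNReal.ofReal (critExp N p)) (volume.restrict Ω) ≤
        C * ‖W01p.grad Ω p u‖ₑ := by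
  have hp1 : 1 < p := hp.out
  have hq := one_lt_critExp hpN
  let C : ℝ≥0 := SNormLESNormFDerivOfEqConst ℝ
    (volume : Measure (EuclideanSpace ℝ (Fin N))) p.toNNReal
  refine ⟨C, fun u => ?_⟩
  obtain ⟨z, hz, hlim⟩ := exists_seq_testPairs u
  have hsob : ∀ n, eLpNorm (z n).1 (ENNReal.ofReal (critExp N p)) (volume.restrict Ω) ≤
      C * ‖(z n).2‖ₑ := by
    intro n
    obtain ⟨φ, ⟨hφ, hφc, -⟩, -, h1, h2⟩ := exists_testFunction_of_mem_testPairs (hz n)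
    rw [← h1, Lp.enorm_def, ← h2]
    refine eLpNorm_le_eLpNorm_fderiv_of_eq volume (hφ.of_le (by simp)) hφc
      (by simpa using hp1.le) ?_ ?_
    · rw [finrank_euclideanSpace_fin]
      rcases Nat.eq_zero_or_pos N with h | h
      · subst h; norm_num at hpN; linarith
      · exact h
    · rw [finrank_euclideanSpace_fin, NNReal.coe_inv, Real.coe_toNNReal _ (by linarith),
        Real.coe_toNNReal _ (by linarith), critExp]
      have : (0 : ℝ) < N := by linarith
      field_simp
  obtain ⟨ns, hns, hae⟩ := exists_subseq_tendsto_ae_of_tendsto_Lp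
    ((continuous_fst.tendsto _).comp hlim)
  have hlim2 : Tendsto (fun n => C * ‖(z (ns n)).2‖ₑ) atTop (𝓝 (C * ‖W01p.grad Ω p u‖ₑ)) := by
    refine ENNReal.Tendsto.const_mul ?_ (Or.inr ENNReal.coe_ne_top)
    exact (continuous_enorm.tendsto _).comp
      (((continuous_snd.tendsto _).comp hlim).comp hns.tendsto_atTop)
  calc eLpNorm u (ENNReal.ofReal (critExp N p)) (volume.restrict Ω)
      ≤ liminf (fun n => eLpNorm (z (ns n)).1 (ENNReal.ofReal (critExp N p))
          (volume.restrict Ω)) atTop :=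
        Lp.eLpNorm_lim_le_liminf_eLpNorm (fun n => Lp.aestronglyMeasurable _) _ hae
    _ ≤ liminf (fun n => C * ‖(z (ns n)).2‖ₑ) atTop :=
        liminf_le_liminf (Eventually.of_forall fun n => hsob _)
    _ = _ := hlim2.liminf_eq

variable [hpN : Fact (p < N)]

instance fact_one_le_critExp : Fact (1 ≤ ENNReal.ofReal (critExp N p)) :=
  ⟨by simpa using ENNReal.ofReal_le_ofReal (one_lt_critExp hpN.out).le⟩

theorem memLp_critExp (u : W01p Ω p) :
    MemLp u (ENNReal.ofReal (critExp N p)) (volume.restrict Ω) := by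
  obtain ⟨C, hC⟩ := exists_sobolev_const (Ω := Ω) hpN.out
  exact ⟨Lp.aestronglyMeasurable _, (hC u).trans_lt (by finiteness)⟩

variable [hΩ : Fact (Bornology.IsBounded Ω)]

instance isFiniteMeasure_restrict_of_isBounded : IsFiniteMeasure (volume.restrict Ω) :=
  MeasureTheory.isFiniteMeasure_restrict.2 hΩ.out.measure_lt_top.ne

/-- The Sobolev embedding of `W_0^{1,p}(Ω)` in `L^{p*}(Ω)`. -/
def sobolevEmbedding (Ω : Set (EuclideanSpace ℝ (Fin N))) (p : ℝ) [Fact (1 < p)]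
    [Fact (Bornology.IsBounded Ω)] [Fact (p < N)] :
    W01p Ω p →L[ℝ] Lp ℝ (ENNReal.ofReal (critExp N p)) (volume.restrict Ω) :=
  LinearMap.mkContinuousOfExistsBound
    { toFun := fun u => (memLp_critExp u).toLp _
      map_add' := fun u v => by
        rw [← MemLp.toLp_add]
        exact MemLp.toLp_congr _ _ (Lp.coeFn_add _ _)
      map_smul' := fun c u => by
        rw [RingHom.id_apply, ← MemLp.toLp_const_smul]
        exact MemLp.toLp_congr _ _ (Lp.coeFn_smul _ _) }
    (by
      obtain ⟨C, hC⟩ := exists_sobolev_const (Ω := Ω) (p := p) (Fact.out : p < N)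
      refine ⟨C, fun u => ?_⟩
      change ‖(memLp_critExp u).toLp _‖ ≤ C * ‖W01p.grad Ω p u‖
      rw [Lp.norm_toLp]
      have := ENNReal.toReal_mono (by finiteness) (hC u)
      simpa [ENNReal.toReal_mul] using this)

theorem coeFn_sobolevEmbedding (u : W01p Ω p) :
    sobolevEmbedding Ω p u =ᵐ[volume.restrict Ω] u :=
  (memLp_critExp u).coeFn_toLp

/-- A form of the Rellich–Kondrachov theorem. -/
theorem exists_subseq_tendsto_ae (hΩo : IsOpen Ω) {u : ℕ → W01p Ω p} {R : ℝ}
    (hu : ∀ n, ‖u n‖ ≤ R) :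
    ∃ ns : ℕ → ℕ, StrictMono ns ∧ ∃ v : EuclideanSpace ℝ (Fin N) → ℝ,
      AEStronglyMeasurable v (volume.restrict Ω) ∧
      ∀ᵐ x ∂(volume.restrict Ω), Tendsto (fun n => u (ns n) x) atTop (𝓝 (v x)) := by
  -- Each `u n` is replaced by a test function at distance below `1/(n+1)`; the difference tends to
  -- zero in `L^p` and disappears along a further subsequence.
  have happ : ∀ n, ∃ z ∈ testPairs Ω p, dist z (Subtype.val (u n)) < 1 / ((n : ℝ) + 1) := by
    intro n
    obtain ⟨z, hz, hlim⟩ := exists_seq_testPairs (u n)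
    obtain ⟨k, hk⟩ := ((Metric.tendsto_nhds.1 hlim) (1 / ((n : ℝ) + 1)) (by positivity)).exists
    exact ⟨z k, hz k, hk⟩
  choose z hz hzu using happ
  choose φ hφ hzφ h1 h2 using fun n => exists_testFunction_of_mem_testPairs (hz n)
  obtain ⟨P, hP⟩ := W01p.poincare (Ω := Ω) (p := p) hΩ.out hpN.out
  have hR : 0 ≤ R := (norm_nonneg _).trans (hu 0)
  have hle1 : ∀ n : ℕ, 1 / ((n : ℝ) + 1) ≤ 1 := fun n => by
    rw [div_le_one (by positivity)]; linarith [(Nat.cast_nonneg n : (0 : ℝ) ≤ n)]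
  have hbd2 : ∀ n, ‖(z n).2‖ ≤ R + 1 := by
    intro n
    have a : dist (z n).2 (Subtype.val (u n)).2 ≤ dist (z n) (Subtype.val (u n)) := le_max_right _ _
    have b := hu n
    change ‖(Subtype.val (u n)).2‖ ≤ R at b
    rw [dist_eq_norm] at a
    have c := norm_le_norm_add_norm_sub' (z n).2 (Subtype.val (u n)).2
    linarith [hzu n, hle1 n]
  have hbd1 : ∀ n, ‖(z n).1‖ ≤ |P| * (R + 1) := by
    intro n
    refine (hP _ (Submodule.le_topologicalClosure _ (hz n))).trans ?_
    exact mul_le_mul (le_abs_self P) (hbd2 n) (norm_nonneg _) (abs_nonneg P)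
  have hp1 : (1 : ℝ≥0∞) ≤ ENNReal.ofReal p := Fact.out
  -- Hölder factor `|Ω|^{1 - 1/p}`, turning `L^p` bounds into `L¹` bounds.
  let V : ℝ≥0∞ := volume.restrict Ω Set.univ ^ (1 / (1 : ℝ≥0∞).toReal - 1 / (ENNReal.ofReal p).toReal)
  have hV : V ≠ ⊤ := by
    have := hp.out
    refine ENNReal.rpow_ne_top_of_nonneg ?_ (measure_ne_top _ _)
    rw [ENNReal.toReal_ofReal (by linarith)]
    simpa using inv_le_one_of_one_le₀ this.le
  let M : ℝ≥0 := (ENNReal.ofReal (|P| * (R + 1)) * V + ENNReal.ofReal (R + 1) * V).toNNReal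
  have hM : (M : ℝ≥0∞) = ENNReal.ofReal (|P| * (R + 1)) * V + ENNReal.ofReal (R + 1) * V :=
    ENNReal.coe_toNNReal (by finiteness)
  have hM1 : ∀ n, ∫⁻ x, ‖φ n x‖ₑ ≤ M := by
    intro n
    rw [← eLpNorm_one_eq_lintegral_enorm, h1, hM]
    refine (eLpNorm_le_eLpNorm_mul_rpow_measure_univ hp1 (Lp.aestronglyMeasurable _)).trans
      (le_trans ?_ le_self_add)
    rw [← Lp.enorm_def, ← ofReal_norm]
    gcongr
    exact hbd1 n
  have hM2 : ∀ n, ∫⁻ x, ‖fderiv ℝ (φ n) x‖ₑ ≤ M := by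
    intro n
    rw [← eLpNorm_one_eq_lintegral_enorm, h2, hM]
    refine (eLpNorm_le_eLpNorm_mul_rpow_measure_univ hp1 (Lp.aestronglyMeasurable _)).trans
      (le_trans ?_ le_add_self)
    rw [← Lp.enorm_def, ← ofReal_norm]
    gcongr
    exact hbd2 n
  have hmem : ∀ n, MemLp (φ n) 1 (volume.restrict Ω) := fun n =>
    ((hφ n).1.continuous.memLp_of_hasCompactSupport (hφ n).2.1).restrict Ω
  let w : ℕ → Lp ℝ 1 (volume.restrict Ω) := fun n => (hmem n).toLp
  have htb : TotallyBounded (Set.range w) := by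
    refine Metric.totallyBounded_iff.2 fun ε hε => ?_
    obtain ⟨B, hB, hBf, hcov⟩ := exists_finite_net_lintegral volume hΩo.measurableSet hΩ.out M
      (A := Set.range φ) (by
        rintro _ ⟨n, rfl⟩
        exact ⟨(hφ n).1.of_le (by simp), (hφ n).2.1, hM1 n, hM2 n⟩)
      (ε := (ε / 2).toNNReal) (by simpa using hε)
    rw [← Set.image_univ] at hB
    obtain ⟨D, -, hDf, hcov⟩ := Set.exists_subset_image_finite_and
      (p := fun t => ∀ φ' ∈ Set.range φ, ∃ χ ∈ t,
        ∫⁻ x in Ω, ‖φ' x - χ x‖ₑ ≤ (ε / 2).toNNReal) |>.1 ⟨B, hB, hBf, hcov⟩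
    refine ⟨w '' D, hDf.image _, ?_⟩
    rintro _ ⟨n, rfl⟩
    obtain ⟨_, ⟨m, hm, rfl⟩, hle⟩ := hcov _ ⟨n, rfl⟩
    refine Set.mem_biUnion ⟨m, hm, rfl⟩ ?_
    rw [Metric.mem_ball, Lp.dist_def, eLpNorm_congr_ae ((hmem n).coeFn_toLp.sub
      (hmem m).coeFn_toLp), eLpNorm_one_eq_lintegral_enorm]
    refine (ENNReal.toReal_le_of_le_ofReal (by positivity) hle).trans_lt (by linarith)
  obtain ⟨v, -, ns, hns, hv⟩ := htb.closure.isCompact_of_isClosed isClosed_closure |>.tendsto_subseq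
    (fun n => subset_closure ⟨n, rfl⟩ : ∀ n, w n ∈ closure (Set.range w))
  obtain ⟨ms, hms, hae⟩ := exists_subseq_tendsto_ae_of_tendsto_Lp hv
  have hdiff : Tendsto (fun n => (z n).1 - (Subtype.val (u n)).1) atTop (𝓝 0) := by
    refine squeeze_zero_norm (fun n => ?_) tendsto_one_div_add_atTop_nhds_zero_nat
    rw [← dist_eq_norm]
    exact (le_max_left _ _ : dist (z n).1 _ ≤ dist (z n) (Subtype.val (u n))).trans (hzu n).le
  obtain ⟨ks, hks, hae2⟩ := exists_subseq_tendsto_ae_of_tendsto_Lp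
    (hdiff.comp (hns.comp hms).tendsto_atTop)
  refine ⟨fun n => ns (ms (ks n)), hns.comp (hms.comp hks), v, Lp.aestronglyMeasurable _, ?_⟩
  have e1 : ∀ᵐ x ∂(volume.restrict Ω), ∀ n, w n x = φ n x :=
    ae_all_iff.2 fun n => (hmem n).coeFn_toLp
  have e2 : ∀ᵐ x ∂(volume.restrict Ω), ∀ n, (z n).1 x = φ n x := ae_all_iff.2 hzφ
  have e3 : ∀ᵐ x ∂(volume.restrict Ω), ∀ n,
      ((z n).1 - (Subtype.val (u n)).1 : Lp ℝ _ _) x = (z n).1 x - u n x :=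
    ae_all_iff.2 fun n => Lp.coeFn_sub _ _
  filter_upwards [hae, hae2, e1, e2, e3, Lp.coeFn_zero ℝ (ENNReal.ofReal p) (volume.restrict Ω)]
    with x a b c d e f
  have a' := a.comp hks.tendsto_atTop
  have := a'.sub b
  simp only [Function.comp_apply, c, e, d, f] at this
  simpa using this

end Embedding

/-! ### Superposition operators with subcritical growth -/

section Superposition

variable {α : Type*} [MeasurableSpace α] {μ : Measure α}

/-- On a simple function the composition is a finite sum of indicators; continuity in `s` carries
measurability to the limit. -/
theorem aemeasurable_comp_of_continuous {k : α → ℝ → ℝ} (hk : ∀ s, AEMeasurable (fun x => k x s) μ)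
    (hc : ∀ᵐ x ∂μ, Continuous (k x)) {u : α → ℝ} (hu : AEStronglyMeasurable u μ) :
    AEMeasurable (fun x => k x (u x)) μ := by
  have hsimple : ∀ w : SimpleFunc α ℝ, AEMeasurable (fun x => k x (w x)) μ := by
    intro w
    have h : (fun x => k x (w x)) =
        fun x => ∑ c ∈ w.range, (w ⁻¹' {c}).indicator (fun x => k x c) x := by
      funext x
      rw [Finset.sum_eq_single (w x)]
      · simp
      · intro c _ hcx
        exact Set.indicator_of_notMem (fun h => hcx h.symm) _
      · intro hx
        exact absurd (SimpleFunc.mem_range_self w x) hx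
    rw [h]
    exact Finset.aemeasurable_fun_sum _ fun c _ => (hk c).indicator (w.measurableSet_fiber c)
  refine aemeasurable_of_tendsto_metrizable_ae atTop
    (f := fun n x => k x (hu.stronglyMeasurable_mk.approx n x)) (fun n => hsimple _) ?_
  filter_upwards [hc, hu.ae_eq_mk] with x hx hux
  rw [hux]
  exact (hx.tendsto _).comp (hu.stronglyMeasurable_mk.tendsto_approx x)

theorem memLp_of_tendsto_ae {u : ℕ → α → ℝ} {v : α → ℝ} {r K : ℝ≥0∞} (hK : K ≠ ⊤)
    (hu : ∀ n, AEStronglyMeasurable (u n) μ) (hv : AEStronglyMeasurable v μ)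
    (hKu : ∀ n, eLpNorm (u n) r μ ≤ K)
    (huv : ∀ᵐ x ∂μ, Tendsto (fun n => u n x) atTop (𝓝 (v x))) : MemLp v r μ := by
  refine ⟨hv, (Lp.eLpNorm_lim_le_liminf_eLpNorm hu v huv).trans_lt (lt_of_le_of_lt ?_ hK.lt_top)⟩
  exact liminf_le_of_le (by isBoundedDefault) fun b hb => by
    obtain ⟨n, hn⟩ := hb.exists
    exact hn.trans (hKu n)

variable {q : ℝ}

/-- Only the constant term needs to see the size of `s`. Thus `s = univ` gives membership in
`L^{q'}`, and small `s` gives uniform integrability. The norm of `|u|^{q-1}` is computed from `(q -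
1) q' = q`. -/
theorem eLpNorm_indicator_le_of_growth (hq : 1 < q) {h u : α → ℝ}
    (hu : AEStronglyMeasurable u μ) {ε C : ℝ} (hε : 0 ≤ ε) (hC : 0 ≤ C)
    (hb : ∀ᵐ x ∂μ, |h x| ≤ ε * |u x| ^ (q - 1) + C) {s : Set α} (hs : MeasurableSet s) :
    eLpNorm (s.indicator h) (ENNReal.ofReal q.conjExponent) μ ≤
      ENNReal.ofReal ε * eLpNorm u (ENNReal.ofReal q) μ ^ (q - 1) +
        ENNReal.ofReal C * μ s ^ (1 / q.conjExponent) := by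
  have hq' := Real.HolderConjugate.conjExponent hq
  have hone : (1 : ℝ≥0∞) ≤ ENNReal.ofReal q.conjExponent := by
    simpa using ENNReal.ofReal_le_ofReal hq'.symm.lt.le
  have hmu : AEStronglyMeasurable (fun x => ‖u x‖ ^ (q - 1)) μ :=
    (hu.norm.aemeasurable.pow_const _).aestronglyMeasurable
  have hle : eLpNorm (s.indicator h) (ENNReal.ofReal q.conjExponent) μ ≤
      eLpNorm ((ε • fun x => ‖u x‖ ^ (q - 1)) + s.indicator fun _ => C)
        (ENNReal.ofReal q.conjExponent) μ := by
    refine eLpNorm_mono_ae ?_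
    filter_upwards [hb] with x hx
    have h0 : 0 ≤ ε * |u x| ^ (q - 1) := by positivity
    by_cases hxs : x ∈ s
    · simp only [Set.indicator_of_mem hxs, Pi.add_apply, Pi.smul_apply, smul_eq_mul,
        Real.norm_eq_abs]
      exact hx.trans (le_abs_self _)
    · rw [Set.indicator_of_notMem hxs, norm_zero]
      exact norm_nonneg _
  refine hle.trans ((eLpNorm_add_le (hmu.const_smul _)
    (aestronglyMeasurable_const.indicator hs) hone).trans (add_le_add ?_ ?_))
  · rw [eLpNorm_const_smul, eLpNorm_norm_rpow _ (by linarith), Real.enorm_of_nonneg hε,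
      ← ENNReal.ofReal_mul hq'.symm.pos.le, mul_comm q.conjExponent, hq'.sub_one_mul_conj]
  · refine (eLpNorm_indicator_const_le C _).trans ?_
    rw [Real.enorm_of_nonneg hC, ENNReal.toReal_ofReal hq'.symm.pos.le]

theorem memLp_conjExponent_of_growth [IsFiniteMeasure μ] (hq : 1 < q) {h u : α → ℝ}
    (hh : AEStronglyMeasurable h μ) (hu : MemLp u (ENNReal.ofReal q) μ) {ε C : ℝ} (hε : 0 ≤ ε)
    (hC : 0 ≤ C) (hb : ∀ᵐ x ∂μ, |h x| ≤ ε * |u x| ^ (q - 1) + C) :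
    MemLp h (ENNReal.ofReal q.conjExponent) μ := by
  refine ⟨hh, ?_⟩
  have hq' := (Real.HolderConjugate.conjExponent hq).symm.pos
  have := eLpNorm_indicator_le_of_growth hq hu.1 hε hC hb MeasurableSet.univ
  rw [Set.indicator_univ] at this
  refine this.trans_lt (ENNReal.add_lt_top.2 ⟨ENNReal.mul_lt_top ENNReal.ofReal_lt_top ?_,
    ENNReal.mul_lt_top ENNReal.ofReal_lt_top ?_⟩)
  · exact ENNReal.rpow_lt_top_of_nonneg (by linarith) hu.2.ne
  · exact ENNReal.rpow_lt_top_of_nonneg (by positivity) (measure_ne_top _ _)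

theorem unifIntegrable_of_growth {ι : Type*} (hq : 1 < q) {h u : ι → α → ℝ}
    (hu : ∀ i, AEStronglyMeasurable (u i) μ) {K : ℝ≥0∞} (hK : K ≠ ⊤)
    (hKu : ∀ i, eLpNorm (u i) (ENNReal.ofReal q) μ ≤ K)
    (hb : ∀ ε > 0, ∃ C ≥ 0, ∀ i, ∀ᵐ x ∂μ, |h i x| ≤ ε * |u i x| ^ (q - 1) + C) :
    UnifIntegrable h (ENNReal.ofReal q.conjExponent) μ := by
  intro ε hε
  have hq' := (Real.HolderConjugate.conjExponent hq).symm.pos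
  have hKq : K ^ (q - 1) ≠ ⊤ := ENNReal.rpow_ne_top_of_nonneg (by linarith) hK
  set L := (K ^ (q - 1)).toReal with hL
  have hL0 : 0 ≤ L := ENNReal.toReal_nonneg
  obtain ⟨C, hC, hbC⟩ := hb (ε / 2 / (L + 1)) (by positivity)
  have hpos : 0 < ε / 2 / (C + 1) := by positivity
  -- Chosen so that its power `1/q'`, multiplied by `C`, is at most `ε / 2`.
  refine ⟨(ε / 2 / (C + 1)) ^ q.conjExponent, by positivity, fun i s hs hμs => ?_⟩
  refine (eLpNorm_indicator_le_of_growth hq (hu i) (by positivity) hC (hbC i) hs).trans ?_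
  calc ENNReal.ofReal (ε / 2 / (L + 1)) * eLpNorm (u i) (ENNReal.ofReal q) μ ^ (q - 1) +
        ENNReal.ofReal C * μ s ^ (1 / q.conjExponent)
      ≤ ENNReal.ofReal (ε / 2 / (L + 1)) * ENNReal.ofReal L +
        ENNReal.ofReal C * ENNReal.ofReal (ε / 2 / (C + 1)) := by
        gcongr
        · rw [hL, ENNReal.ofReal_toReal hKq]
          exact ENNReal.rpow_le_rpow (hKu i) (by linarith)
        · refine (ENNReal.rpow_le_rpow hμs (by positivity)).trans (le_of_eq ?_)
          rw [ENNReal.ofReal_rpow_of_pos (by positivity), ← Real.rpow_mul hpos.le,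
            mul_one_div_cancel hq'.ne', Real.rpow_one]
    _ ≤ ENNReal.ofReal ε := by
        rw [← ENNReal.ofReal_mul (by positivity), ← ENNReal.ofReal_mul hC,
          ← ENNReal.ofReal_add (by positivity) (by positivity)]
        refine ENNReal.ofReal_le_ofReal ?_
        have h1 : ε / 2 / (L + 1) * L ≤ ε / 2 := by
          rw [div_mul_eq_mul_div, div_le_iff₀ (by positivity)]
          gcongr
          simp
        have h2 : C * (ε / 2 / (C + 1)) ≤ ε / 2 := by
          rw [mul_comm, div_mul_eq_mul_div, div_le_iff₀ (by positivity)]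
          gcongr
          simp
        linarith

/-- `g : (λ, x, s) ↦ g λ x s` is Carathéodory and, for `λ ∈ J`, has growth `o(|s|^{q-1})`. -/
structure HasSubcriticalGrowth (μ : Measure α) (q : ℝ) (J : Set ℝ) (g : ℝ → α → ℝ → ℝ) :
    Prop where
  aemeasurable : ∀ l s, AEMeasurable (fun x => g l x s) μ
  continuous : ∀ᵐ x ∂μ, Continuous fun z : ℝ × ℝ => g z.1 x z.2
  growth : ∀ ε > 0, ∃ C ≥ 0, ∀ᵐ x ∂μ, ∀ l ∈ J, ∀ s, |g l x s| ≤ ε * |s| ^ (q - 1) + C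

namespace HasSubcriticalGrowth

variable {J : Set ℝ} {g : ℝ → α → ℝ → ℝ}

theorem aestronglyMeasurable_comp (hg : HasSubcriticalGrowth μ q J g) (l : ℝ) {u : α → ℝ}
    (hu : AEStronglyMeasurable u μ) : AEStronglyMeasurable (fun x => g l x (u x)) μ := by
  refine (aemeasurable_comp_of_continuous (hg.aemeasurable l) ?_ hu).aestronglyMeasurable
  filter_upwards [hg.continuous] with x hx
  exact hx.comp (Continuous.prodMk_right l)

theorem memLp_comp [IsFiniteMeasure μ] (hg : HasSubcriticalGrowth μ q J g) (hq : 1 < q) {l : ℝ}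
    (hl : l ∈ J) {u : α → ℝ} (hu : MemLp u (ENNReal.ofReal q) μ) :
    MemLp (fun x => g l x (u x)) (ENNReal.ofReal q.conjExponent) μ := by
  obtain ⟨C, hC, hb⟩ := hg.growth 1 one_pos
  refine memLp_conjExponent_of_growth hq (hg.aestronglyMeasurable_comp l hu.1) hu zero_le_one hC ?_
  filter_upwards [hb] with x hx using hx l hl _

/-- Vitali's theorem: joint continuity in `(λ, s)` gives a.e. convergence, and the growth bound
gives uniform integrability. -/
theorem tendsto_eLpNorm_comp_sub [IsFiniteMeasure μ] (hg : HasSubcriticalGrowth μ q J g)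
    (hq : 1 < q) {l : ℕ → ℝ} {l₀ : ℝ} (hl : ∀ n, l n ∈ J) (hl₀ : l₀ ∈ J)
    (hll : Tendsto l atTop (𝓝 l₀)) {u : ℕ → α → ℝ} {v : α → ℝ} {K : ℝ≥0∞} (hK : K ≠ ⊤)
    (hu : ∀ n, AEStronglyMeasurable (u n) μ) (hv : AEStronglyMeasurable v μ)
    (hKu : ∀ n, eLpNorm (u n) (ENNReal.ofReal q) μ ≤ K)
    (huv : ∀ᵐ x ∂μ, Tendsto (fun n => u n x) atTop (𝓝 (v x))) :
    Tendsto (fun n => eLpNorm ((fun x => g (l n) x (u n x)) - fun x => g l₀ x (v x))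
      (ENNReal.ofReal q.conjExponent) μ) atTop (𝓝 0) := by
  have hq' := Real.HolderConjugate.conjExponent hq
  refine tendsto_Lp_finite_of_tendsto_ae
    (by simpa using ENNReal.ofReal_le_ofReal hq'.symm.lt.le) ENNReal.ofReal_ne_top
    (fun n => hg.aestronglyMeasurable_comp _ (hu n))
    (hg.memLp_comp hq hl₀ (memLp_of_tendsto_ae hK hu hv hKu huv))
    (unifIntegrable_of_growth hq hu hK hKu fun ε hε => ?_) ?_
  · obtain ⟨C, hC, hb⟩ := hg.growth ε hε
    refine ⟨C, hC, fun n => ?_⟩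
    filter_upwards [hb] with x hx using hx _ (hl n) _
  · filter_upwards [hg.continuous, huv] with x hx hxu
    exact (hx.tendsto (l₀, v x)).comp (hll.prodMk_nhds hxu)

end HasSubcriticalGrowth

end Superposition

/-! ### Growth bound with small leading constant; sequential compactness criterion -/

theorem SlightlySubcritical.exists_le {N : ℕ} {p : ℝ} {f : ℝ → ℝ}
    (hf : SlightlySubcritical N p f) (hmono : MonotoneOn f (Set.Ici 0)) (h0 : f 0 = 0)
    {ε : ℝ} (hε : 0 < ε) :
    ∃ C ≥ 0, ∀ s ≥ 0, f s ≤ ε * s ^ (critExp N p - 1) + C := by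
  obtain ⟨S, hS⟩ := eventually_atTop.1 (hf.eventually (gt_mem_nhds hε))
  -- Below `max S 1` monotonicity bounds `f`; above it the limit does, and the `1` ensures `s > 0`
  -- when clearing the denominator.
  have hS1 : (0 : ℝ) ≤ max S 1 := by positivity
  refine ⟨f (max S 1), ?_, fun s hs => ?_⟩
  · rw [ge_iff_le, ← h0]
    exact hmono Set.self_mem_Ici hS1 hS1
  have hC : 0 ≤ f (max S 1) := by
    rw [← h0]
    exact hmono Set.self_mem_Ici hS1 hS1
  rcases le_total s (max S 1) with h | h
  · have := hmono hs hS1 h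
    have : 0 ≤ ε * s ^ (critExp N p - 1) := by positivity
    linarith
  · have hs0 : 0 < s := by linarith [le_max_right S 1]
    have := hS s ((le_max_left _ _).trans h)
    rw [abs_of_pos hs0, div_lt_iff₀ (by positivity)] at this
    linarith

/-- A sequence in the closure is shadowed by one in `A` at distances `1/(n+1)`. The limit need not
lie in `A`, so the limit functional need not be a value of the operator. -/
theorem isCompact_closure_of_subseq {X : Type*} [PseudoMetricSpace X] {A : Set X}
    (h : ∀ x : ℕ → X, (∀ n, x n ∈ A) →
      ∃ a, ∃ ns : ℕ → ℕ, StrictMono ns ∧ Tendsto (x ∘ ns) atTop (𝓝 a)) :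
    IsCompact (closure A) := by
  refine IsSeqCompact.isCompact fun y hy => ?_
  have happ : ∀ n, ∃ x ∈ A, dist (y n) x < 1 / ((n : ℝ) + 1) := fun n =>
    Metric.mem_closure_iff.1 (hy n) _ (by positivity)
  choose x hx hxy using happ
  obtain ⟨a, ns, hns, hlim⟩ := h x hx
  have hya : Tendsto (y ∘ ns) atTop (𝓝 a) := by
    refine hlim.congr_dist ?_
    refine squeeze_zero (fun _ => dist_nonneg) (fun n => ?_)
      (tendsto_one_div_add_atTop_nhds_zero_nat.comp hns.tendsto_atTop)
    rw [dist_comm]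
    exact (hxy _).le
  exact ⟨a, isClosed_closure.mem_of_tendsto hya (Eventually.of_forall fun n => hy _), ns, hns, hya⟩

/-! ### The adjoint of the Sobolev embedding -/

section Dual

variable {N : ℕ} (Ω : Set (EuclideanSpace ℝ (Fin N))) (p : ℝ) [hp : Fact (1 < p)]
  [hpN : Fact (p < N)]

/-- The exponent conjugate to `p*`. -/
abbrev dualExp (N : ℕ) (p : ℝ) : ℝ≥0∞ := ENNReal.ofReal (critExp N p).conjExponent

instance holderConjugate_dualExp :
    (dualExp N p).HolderConjugate (ENNReal.ofReal (critExp N p)) :=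
  (Real.HolderConjugate.conjExponent (one_lt_critExp hpN.out)).symm.ennrealOfReal

instance fact_one_le_dualExp : Fact (1 ≤ dualExp N p) :=
  ⟨by
    simpa using ENNReal.ofReal_le_ofReal
      (Real.HolderConjugate.conjExponent (one_lt_critExp hpN.out)).symm.lt.le⟩

variable [hΩ : Fact (Bornology.IsBounded Ω)]

/-- `h ↦ (ψ ↦ ∫_Ω h ψ)`, from `L^{(p*)'}(Ω)` to `W^{-1,p'}(Ω)`. -/
def toDual : Lp ℝ (dualExp N p) (volume.restrict Ω) →L[ℝ] WNeg Ω p :=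
  ((ContinuousLinearMap.compL ℝ (W01p Ω p) _ ℝ).flip (sobolevEmbedding Ω p)).comp
    ((ContinuousLinearMap.mul ℝ ℝ).lpPairing (volume.restrict Ω) (dualExp N p)
      (ENNReal.ofReal (critExp N p)))

variable {Ω p}

theorem toDual_toLp_apply {h : EuclideanSpace ℝ (Fin N) → ℝ}
    (hh : MemLp h (dualExp N p) (volume.restrict Ω)) (ψ : W01p Ω p) :
    toDual Ω p hh.toLp ψ = ∫ x in Ω, h x * ψ x := by
  have : toDual Ω p hh.toLp ψ =
      (ContinuousLinearMap.mul ℝ ℝ).lpPairing (volume.restrict Ω) (dualExp N p)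
        (ENNReal.ofReal (critExp N p)) hh.toLp (sobolevEmbedding Ω p ψ) := rfl
  rw [this, ContinuousLinearMap.lpPairing_eq_integral]
  refine integral_congr_ae ?_
  filter_upwards [hh.coeFn_toLp, coeFn_sobolevEmbedding ψ] with x h1 h2
  simp [h1, h2]

end Dual

/-! ### Continuity and compactness of the operator -/

theorem exists_isNemytskii_isCompactMap {N : ℕ} {p : ℝ} [hp : Fact (1 < p)] [hpN : Fact (p < N)]
    {Ω : Set (EuclideanSpace ℝ (Fin N))} (hΩo : IsOpen Ω) [Fact (Bornology.IsBounded Ω)]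
    {I : Set ℝ} (hI : IsCompact I) {g : ℝ → EuclideanSpace ℝ (Fin N) → ℝ → ℝ}
    (hg : HasSubcriticalGrowth (volume.restrict Ω) (critExp N p) I g) :
    ∃ T : I × W01p Ω p → WNeg Ω p, IsNemytskii Ω p I g T ∧ IsCompactMap T := by
  have hq := one_lt_critExp (p := p) hpN.out
  have hmem : ∀ z : I × W01p Ω p,
      MemLp (fun x => g z.1 x (z.2 x)) (dualExp N p) (volume.restrict Ω) :=
    fun z => hg.memLp_comp hq z.1.2 (memLp_critExp z.2)
  let T : I × W01p Ω p → WNeg Ω p := fun z => toDual Ω p (hmem z).toLp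
  obtain ⟨C, hC⟩ := exists_sobolev_const (Ω := Ω) (p := p) hpN.out
  have hK : ∀ {R : ℝ} (u : W01p Ω p), ‖u‖ ≤ R →
      eLpNorm u (ENNReal.ofReal (critExp N p)) (volume.restrict Ω) ≤ C * ENNReal.ofReal R := by
    intro R u hu
    refine (hC u).trans ?_
    rw [← ofReal_norm]
    gcongr
    exact hu
  -- Serves both continuity and compactness. Here `v` is merely an a.e. limit, not assumed to belong
  -- to `W_0^{1,p}(Ω)`; Fatou places it in `L^{p*}`.
  have key : ∀ (z : ℕ → I × W01p Ω p) (l : I) (v : EuclideanSpace ℝ (Fin N) → ℝ) (R : ℝ),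
      (∀ n, ‖(z n).2‖ ≤ R) → Tendsto (fun n => (z n).1) atTop (𝓝 l) →
      AEStronglyMeasurable v (volume.restrict Ω) →
      (∀ᵐ x ∂(volume.restrict Ω), Tendsto (fun n => (z n).2 x) atTop (𝓝 (v x))) →
      ∃ hh : MemLp (fun x => g l x (v x)) (dualExp N p) (volume.restrict Ω),
        Tendsto (fun n => T (z n)) atTop (𝓝 (toDual Ω p hh.toLp)) := by
    intro z l v R hR hl hv huv
    have hv' : MemLp v (ENNReal.ofReal (critExp N p)) (volume.restrict Ω) :=
      memLp_of_tendsto_ae (K := C * ENNReal.ofReal R) (by finiteness)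
        (fun n => Lp.aestronglyMeasurable _) hv (fun n => hK _ (hR n)) huv
    refine ⟨hg.memLp_comp hq l.2 hv', ((toDual Ω p).continuous.tendsto _).comp
      ((Lp.tendsto_Lp_iff_tendsto_eLpNorm'' _ (fun n => hmem (z n)) _ _).2 ?_)⟩
    exact hg.tendsto_eLpNorm_comp_sub hq (fun n => (z n).1.2) l.2
      ((continuous_subtype_val.tendsto _).comp hl) (K := C * ENNReal.ofReal R) (by finiteness)
      (fun n => Lp.aestronglyMeasurable _) hv (fun n => hK _ (hR n)) huv
  refine ⟨T, fun l u ψ => ⟨?_, toDual_toLp_apply (hmem (l, u)) ψ⟩, ?_, fun B hB => ?_⟩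
  · exact MemLp.integrable_mul (hmem (l, u)) (memLp_critExp ψ)
  · refine continuous_iff_continuousAt.2 fun z₀ => tendsto_of_subseq_tendsto fun z hz => ?_
    have hz1 := (continuous_fst.tendsto _).comp hz
    have hz2 := (continuous_snd.tendsto _).comp hz
    obtain ⟨R, hR⟩ := hz2.norm.bddAbove_range
    obtain ⟨ns, hns, hae⟩ := exists_subseq_tendsto_ae_of_tendsto_Lp
      (((sobolevEmbedding Ω p).continuous.tendsto _).comp hz2)
    have e : ∀ᵐ x ∂(volume.restrict Ω), ∀ n, sobolevEmbedding Ω p (z n).2 x = (z n).2 x :=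
      ae_all_iff.2 fun n => coeFn_sobolevEmbedding _
    obtain ⟨hh, hlim⟩ := key (z ∘ ns) z₀.1 z₀.2 R (fun n => hR ⟨ns n, rfl⟩)
      (hz1.comp hns.tendsto_atTop) (Lp.aestronglyMeasurable _) (by
        filter_upwards [hae, e, coeFn_sobolevEmbedding z₀.2] with x h1 h2 h3
        simpa [h2, h3] using h1)
    -- The limit supplied by `key` is `T z₀` by definition, whichever proof of integrability is
    -- used.
    exact ⟨ns, hlim⟩
  · obtain ⟨R, hR⟩ := (LipschitzWith.prod_snd.isBounded_image hB).exists_norm_le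
    refine isCompact_closure_of_subseq fun y hy => ?_
    choose z hz hzy using hy
    obtain ⟨ns, hns, v, hv, hae⟩ := exists_subseq_tendsto_ae hΩo (u := fun n => (z n).2)
      fun n => hR _ ⟨z n, hz n, rfl⟩
    obtain ⟨l, hl, ms, hms, hlim⟩ := hI.tendsto_subseq fun n => (z (ns n)).1.2
    obtain ⟨hh, h⟩ := key (fun n => z (ns (ms n))) ⟨l, hl⟩ v R
      (fun n => hR _ ⟨_, hz _, rfl⟩) (tendsto_subtype_rng.2 hlim) hv (by
        filter_upwards [hae] with x hx using hx.comp hms.tendsto_atTop)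
    refine ⟨_, fun n => ns (ms n), hns.comp hms, h.congr fun n => ?_⟩
    exact hzy _

end Sobolev

end

theorem mainTheorem5 {N : ℕ} (p : ℝ) [Fact (1 < p)] [Fact (p < N)]
    (Ω : Set (EuclideanSpace ℝ (Fin N))) (hΩ : IsOpen Ω) [Fact (Bornology.IsBounded Ω)]
    (g : ℝ → EuclideanSpace ℝ (Fin N) → ℝ → ℝ) (hg : Sobolev.IsCaratheodory Ω g)
    (hgrowth : ∀ J : Set ℝ, Bornology.IsBounded J → ∃ f : ℝ → ℝ,
      ContinuousOn f (Set.Ici 0) ∧ StrictMonoOn f (Set.Ici 0) ∧ f 0 = 0 ∧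
      Sobolev.SlightlySubcritical N p f ∧ Sobolev.SuperlinearAtInfinity f ∧
      ∀ᵐ x ∂(volume.restrict Ω), ∀ l ∈ J, ∀ s : ℝ, |g l x s| ≤ f |s|)
    (a b : ℝ) :
    ∃ T : Set.Icc a b × Sobolev.W01p Ω p → Sobolev.WNeg Ω p,
      Sobolev.IsNemytskii Ω p (Set.Icc a b) g T ∧ Sobolev.IsCompactMap T := by
  obtain ⟨f, -, hmono, h0, hsub, -, hb⟩ := hgrowth (Set.Icc a b) (Metric.isBounded_Icc a b)
  refine Sobolev.exists_isNemytskii_isCompactMap hΩ isCompact_Icc ⟨hg.1, hg.2, fun ε hε => ?_⟩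
  obtain ⟨C, hC, hf⟩ := hsub.exists_le hmono.monotoneOn h0 hε
  refine ⟨C, hC, ?_⟩
  filter_upwards [hb] with x hx l hl s
  exact (hx l hl s).trans (hf _ (abs_nonneg s))
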